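/- Let $n \ge 2$, and let $d \ge 4$ be an even number. There exists a form (homogeneous polynomial) $f \in \mathbb{Q}[x_0,\dots,x_n]$ of degree $d$ with the following properties: (1) $f$ is irreducible over $\mathbb{Q}$, and decomposes into a product of $d$ linear forms over $\mathbb{C}$; (2) $f$ is a sum of two squares in $\mathbb{R}[x_0,\dots,x_n]$; (3) $f$ is not a sum of any number of squares in $\mathbb{Q}[x_0,\dots,x_n]$. For example, for $n = 2$ and $d = 4$, $$f = x_0^4 + x_0x_1^3 + x_1^4 - 3x_0^2x_1x_2 - 4x_0x_1^2x_2 + 2x_0^2x_2^2 + x_0x_2^3 + x_1x_2^3 + x_2^4$$ is such a form. -/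

import Mathlib

open MvPolynomial

/-- `g` decomposes into a product of `d` linear forms. -/
def IsProdOfLinearForms {σ R : Type*} [CommRing R] (d : ℕ) (g : MvPolynomial σ R) : Prop :=
  ∃ l : Fin d → MvPolynomial σ R, (∀ i, (l i).IsHomogeneous 1) ∧ g = ∏ i, l i

/-- `g` is a sum of two squares in the ring `R`. -/
def IsSumTwoSq {R : Type*} [CommRing R] (g : R) : Prop :=
  ∃ p q : R, g = p ^ 2 + q ^ 2

/-- The form `f ∈ ℚ[x_0, …, x_n]` of degree `d` is irreducible over `ℚ`, decomposes into linear
forms over `ℂ`, is a sum of two squares over `ℝ`, and is not a sum of any number of squares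
over `ℚ`. -/
structure IsSOSCounterexample (n d : ℕ) (f : MvPolynomial (Fin (n + 1)) ℚ) : Prop where
  isHomogeneous : f.IsHomogeneous d
  irreducible : Irreducible f
  splits : IsProdOfLinearForms d (map (algebraMap ℚ ℂ) f)
  sum_two_sq : IsSumTwoSq (map (algebraMap ℚ ℝ) f)
  not_sum_sq : ¬ IsSumSq f

/-- The explicit ternary quartic form. -/
noncomputable def exampleQuartic : MvPolynomial (Fin (2 + 1)) ℚ :=
  X 0 ^ 4 + X 0 * X 1 ^ 3 + X 1 ^ 4 - 3 * X 0 ^ 2 * X 1 * X 2 - 4 * X 0 * X 1 ^ 2 * X 2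
    + 2 * X 0 ^ 2 * X 2 ^ 2 + X 0 * X 2 ^ 3 + X 1 * X 2 ^ 3 + X 2 ^ 4

/-! Let `F` be the product of the lines `X i + a X j + a² X k` over the complex roots `a` of a monic
`g` over `ℚ` without real roots; it has rational coefficients. Suppose that over some extension
field `g` is a linear factor times an irreducible one. Then `g` is irreducible, hence so is `F`. The
roots come in conjugate pairs, so `F = H * conj H` with `H = u + iv`, that is, `F = u² + v²` over
`ℝ`.

Over `ℚ` squares fail (`not_isSumSq_of_map_eq_prod_lineForm`). Two conjugate lines meet in the real
point `P = (αᾱ, -(α + ᾱ), 1)`, a zero of `F`, so every `b` in `F = ∑ b²` vanishes at `P`. Put `B(x,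
y) = b(xy, -(x + y), 1)`. Its `y`-degree is at most half that of `g`, whereas `ᾱ` has degree `deg g
- 1` over `ℚ(α)`; so `B(α, y) = 0` and `g(x)` divides `B`. Then `g(x)²` divides `F(xy, -(x + y), 1)
= g(x) g(y)`, which is absurd.

Suitable `g` come from Hensel's lemma: `x ^ (m + 1) - x ^ m + 2` with `m` odd over `ℚ_[2]`, and `x ^
4 - x + 1` over `ℚ_[3]` for the explicit quartic. -/

/-! ### Products of conjugate lines and their descent to the base field -/

section LineForm

variable {σ : Type*}

/-- The linear form `X i + a X j + a² X k`. -/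
noncomputable def lineForm {R : Type*} [CommRing R] (i j k : σ) (a : R) : MvPolynomial σ R :=
  X i + C a * X j + C (a ^ 2) * X k

theorem isHomogeneous_lineForm {R : Type*} [CommRing R] (i j k : σ) (a : R) :
    (lineForm i j k a).IsHomogeneous 1 :=
  ((isHomogeneous_X R i).add (isHomogeneous_C_mul_X a j)).add (isHomogeneous_C_mul_X (a ^ 2) k)

theorem map_lineForm {R S : Type*} [CommRing R] [CommRing S] (φ : R →+* S) (i j k : σ) (a : R) :
    map φ (lineForm i j k a) = lineForm i j k (φ a) := by
  simp [lineForm]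

theorem isProdOfLinearForms_lineForm {R : Type*} [CommRing R] (i j k : σ) (s : Multiset R) :
    IsProdOfLinearForms s.card (s.map (lineForm i j k)).prod := by
  obtain ⟨l, rfl⟩ : ∃ l : List R, (l : Multiset R) = s := ⟨s.toList, s.coe_toList⟩
  refine ⟨fun m : Fin l.length => lineForm i j k (l.get m),
    fun m => isHomogeneous_lineForm i j k _, ?_⟩
  rw [Multiset.map_coe, Multiset.prod_coe]
  refine Eq.trans ?_ (List.prod_ofFn (f := fun m : Fin l.length => lineForm i j k (l.get m)))
  congr 1
  exact List.ext_get (by simp) (by simp)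

theorem IsProdOfLinearForms.isHomogeneous {R : Type*} [CommRing R] {d : ℕ} {f : MvPolynomial σ R}
    (h : IsProdOfLinearForms d f) : f.IsHomogeneous d := by
  obtain ⟨l, hl, rfl⟩ := h
  simpa using IsHomogeneous.prod Finset.univ l (fun _ => 1) (fun i _ => hl i)

theorem isHomogeneous_of_map_injective {R S : Type*} [CommRing R] [CommRing S] {φ : R →+* S}
    (hφ : Function.Injective φ) {d : ℕ} {f : MvPolynomial σ R} (h : (map φ f).IsHomogeneous d) :
    f.IsHomogeneous d := by
  intro m hm
  refine h (d := m) ?_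
  rw [coeff_map]
  exact fun h0 => hm (hφ (h0.trans (map_zero φ).symm))

/-- The resultant in `T` of `g` and `X i + T X j + T² X k` has coefficients in `K`, and over `E` it
is the product of the values of the second polynomial at the roots of `g`. -/
theorem exists_map_eq_prod_lineForm {K E : Type*} [Field K] [Field E] [IsAlgClosed E] [Algebra K E]
    (g : Polynomial K) (hg : g.Monic) (i j k : σ) :
    ∃ F : MvPolynomial σ K,
      map (algebraMap K E) F = ((g.aroots E).map (lineForm i j k)).prod := by
  let q : Polynomial (MvPolynomial σ K) :=
    Polynomial.C (X i) + Polynomial.X * Polynomial.C (X j) + Polynomial.X ^ 2 * Polynomial.C (X k)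
  let gE := g.map (algebraMap K E)
  have hgE : gE.Monic := hg.map _
  have hsp : gE.Splits := IsAlgClosed.splits gE
  have hsp' : (gE.map (C : E →+* MvPolynomial σ E)).Splits := hsp.map _
  have hroots : (gE.map (C : E →+* MvPolynomial σ E)).roots = gE.roots.map C :=
    (Polynomial.roots_map_of_injective_of_card_eq_natDegree (C_injective σ E)
      hsp.natDegree_eq_card_roots.symm).symm
  have hdeg : (gE.map (C : E →+* MvPolynomial σ E)).natDegree = g.natDegree := by
    rw [Polynomial.natDegree_map_eq_of_injective (C_injective σ E), Polynomial.natDegree_map]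
  refine ⟨Polynomial.resultant (g.map C) q g.natDegree 2, ?_⟩
  rw [← Polynomial.resultant_map_map, Polynomial.map_map]
  have h1 : (map (algebraMap K E)).comp (C : K →+* MvPolynomial σ K) = C.comp (algebraMap K E) := by
    ext; simp
  have h2 : q.map (map (algebraMap K E)) = Polynomial.C (X i) + Polynomial.X * Polynomial.C (X j) +
      Polynomial.X ^ 2 * Polynomial.C (X k) := by simp [q]
  rw [h1, h2, ← Polynomial.map_map, ← hdeg, Polynomial.resultant_eq_prod_eval _ _ _ _ hsp', hroots,
    (hgE.map C).leadingCoeff, one_pow, one_mul, Multiset.map_map]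
  · congr 1
    refine Multiset.map_congr rfl fun a _ => ?_
    simp [lineForm]
    ring
  ·     compute_degree

end LineForm

/-! ### Two squares over the reals -/

section TwoSquares

variable {σ : Type*}

theorem exists_re_im (H : MvPolynomial σ ℂ) :
    ∃ u v : MvPolynomial σ ℝ,
      H = map (algebraMap ℝ ℂ) u + C Complex.I * map (algebraMap ℝ ℂ) v := by
  induction H using MvPolynomial.induction_on with
  | C a =>
    refine ⟨C a.re, C a.im, ?_⟩
    rw [map_C, map_C, ← C_mul, ← C_add]
    congr 1
    simpa [mul_comm] using (Complex.re_add_im a).symm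
  | add p q hp hq =>
    obtain ⟨u, v, rfl⟩ := hp
    obtain ⟨u', v', rfl⟩ := hq
    exact ⟨u + u', v + v', by simp only [map_add]; ring⟩
  | mul_X p n hp =>
    obtain ⟨u, v, rfl⟩ := hp
    exact ⟨u * X n, v * X n, by simp only [map_mul, map_X]; ring⟩

theorem isSumTwoSq_of_map_eq_mul_conj {f : MvPolynomial σ ℝ} {H : MvPolynomial σ ℂ}
    (h : map (algebraMap ℝ ℂ) f = H * map (starRingEnd ℂ) H) : IsSumTwoSq f := by
  obtain ⟨u, v, rfl⟩ := exists_re_im H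
  refine ⟨u, v, map_injective _ (algebraMap ℝ ℂ).injective ?_⟩
  have hc : (starRingEnd ℂ).comp (algebraMap ℝ ℂ) = algebraMap ℝ ℂ := by ext; simp
  have hI : (C Complex.I : MvPolynomial σ ℂ) ^ 2 = -1 := by rw [← C_pow, Complex.I_sq]; simp
  rw [h]
  simp only [map_add, map_mul, map_pow, map_map, hc, map_C, Complex.conj_I, C_neg]
  linear_combination (-(map (algebraMap ℝ ℂ) v) ^ 2) * hI

/-- Take for `H` the product over the roots in the upper half-plane; conjugation carries it to the
product over the others. -/
theorem isSumTwoSq_of_conj_roots {f : MvPolynomial σ ℝ} {s : Multiset ℂ} {i j k : σ}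
    (hs : s.Nodup) (hconj : ∀ a ∈ s, starRingEnd ℂ a ∈ s) (him : ∀ a ∈ s, a.im ≠ 0)
    (hf : map (algebraMap ℝ ℂ) f = (s.map (lineForm i j k)).prod) : IsSumTwoSq f := by
  classical
  have hneg : s.filter (fun a => ¬ 0 < a.im) =
      (s.filter (fun a => 0 < a.im)).map (starRingEnd ℂ) := by
    refine (Multiset.Nodup.ext (hs.filter _)
      ((hs.filter _).map (starRingEnd ℂ).injective)).2 fun a => ?_
    simp only [Multiset.mem_filter, Multiset.mem_map, not_lt]
    constructor
    · rintro ⟨ha, h0⟩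
      refine ⟨starRingEnd ℂ a, ⟨hconj a ha, ?_⟩, Complex.conj_conj a⟩
      simpa using lt_of_le_of_ne h0 (him a ha)
    · rintro ⟨b, ⟨hb, h0⟩, rfl⟩
      exact ⟨hconj b hb, by simpa using h0.le⟩
  refine isSumTwoSq_of_map_eq_mul_conj
    (H := ((s.filter (fun a => 0 < a.im)).map (lineForm i j k)).prod) ?_
  have hsum := congrArg (fun t => (t.map (lineForm i j k)).prod)
    (Multiset.filter_add_not (fun a : ℂ => 0 < a.im) s)
  simp only [Multiset.map_add, Multiset.prod_add, hneg, Multiset.map_map] at hsum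
  rw [hf, ← hsum, map_multiset_prod, Multiset.map_map]
  congr 2
  refine Multiset.map_congr rfl fun a _ => ?_
  simp [map_lineForm]

end TwoSquares

/-! ### No cancellation of leading terms in sums of squares -/

section SumsOfSquares

theorem isSumSq_map {R S : Type*} [CommRing R] [CommRing S] (φ : R →+* S) {s : R}
    (hs : IsSumSq s) : IsSumSq (φ s) := by
  induction hs with
  | zero => rw [map_zero]; exact IsSumSq.zero
  | sq_add a _ ih => rw [map_add, map_mul]; exact IsSumSq.sq_add _ ih

/-- `hR` prevents top coefficients that are sums of squares from cancelling. It is applied with `R =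
ℚ[x]`, to polynomials in `y`. -/
theorem isSumSq_leadingCoeff {R : Type*} [CommRing R] [IsDomain R]
    (hR : ∀ s t : R, IsSumSq s → IsSumSq t → s + t = 0 → s = 0) {p : Polynomial R}
    (hp : IsSumSq p) : IsSumSq p.leadingCoeff := by
  induction hp with
  | zero => simp [IsSumSq.zero]
  | @sq_add a s hs ih =>
    have ha : IsSumSq (a * a).leadingCoeff := by
      rw [Polynomial.leadingCoeff_mul]; exact IsSumSq.mul_self _
    rcases lt_trichotomy (a * a).degree s.degree with h | h | h
    · rwa [Polynomial.leadingCoeff_add_of_degree_lt h]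
    · by_cases h0 : (a * a).leadingCoeff + s.leadingCoeff = 0
      · have h1 := hR _ _ ha ih h0
        rw [Polynomial.leadingCoeff_eq_zero] at h1
        rwa [h1, zero_add]
      · rw [Polynomial.leadingCoeff_add_of_degree_eq h h0]
        exact ha.add ih
    · rwa [Polynomial.leadingCoeff_add_of_degree_lt' h]

theorem natDegree_le_natDegree_add_of_isSumSq {R : Type*} [CommRing R] [IsDomain R]
    (hR : ∀ s t : R, IsSumSq s → IsSumSq t → s + t = 0 → s = 0) {p q : Polynomial R}
    (hp : IsSumSq p) (hq : IsSumSq q) : p.natDegree ≤ (p + q).natDegree := by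
  rcases eq_or_ne p 0 with rfl | hp0
  · simp
  refine Polynomial.natDegree_le_natDegree ?_
  rcases lt_trichotomy p.degree q.degree with h | h | h
  · rw [Polynomial.degree_add_eq_right_of_degree_lt h]; exact h.le
  · rw [Polynomial.degree_add_eq_of_leadingCoeff_add_ne_zero, ← h, max_self]
    intro h0
    exact hp0 (Polynomial.leadingCoeff_eq_zero.1
      (hR _ _ (isSumSq_leadingCoeff hR hp) (isSumSq_leadingCoeff hR hq) h0))
  · rw [Polynomial.degree_add_eq_left_of_degree_lt h]

theorem polynomial_eq_zero_of_isSumSq_add_eq_zero {K : Type*} [Field K] [LinearOrder K]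
    [IsStrictOrderedRing K] {s t : Polynomial K} (hs : IsSumSq s) (ht : IsSumSq t)
    (h : s + t = 0) : s = 0 := by
  refine Polynomial.funext fun x => ?_
  have h1 := (isSumSq_map (Polynomial.evalRingHom x) hs).nonneg
  have h2 := (isSumSq_map (Polynomial.evalRingHom x) ht).nonneg
  have h3 := congrArg (Polynomial.evalRingHom x) h
  simp only [map_add, map_zero, Polynomial.coe_evalRingHom] at h1 h2 h3
  simp only [Polynomial.eval_zero]
  linarith

end SumsOfSquares

/-! ### Restricting the form to a line and to intersection points -/

section Substitutions

variable {σ : Type*}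

open Classical in
/-- The substitution `X i ↦ x y`, `X j ↦ -(x + y)`, `X k ↦ 1`, all other variables `↦ 0`. -/
noncomputable def symmSubst {A : Type*} [CommRing A] (i j k : σ) (x y : A) : σ → A :=
  fun s => if s = i then x * y else if s = j then -(x + y) else if s = k then 1 else 0

theorem map_symmSubst {A B : Type*} [CommRing A] [CommRing B] (φ : A →+* B) (i j k : σ) (x y : A)
    (s : σ) : φ (symmSubst i j k x y s) = symmSubst i j k (φ x) (φ y) s := by
  unfold symmSubst
  split_ifs <;> simp

/-- The substituted point is where the lines with parameters `x` and `y` meet. -/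
theorem aeval_symmSubst_lineForm {R A : Type*} [CommRing R] [CommRing A] [Algebra R A]
    {i j k : σ} (hij : i ≠ j) (hik : i ≠ k) (hjk : j ≠ k) (x y : A) (a : R) :
    aeval (symmSubst i j k x y) (lineForm i j k a) =
      (x - algebraMap R A a) * (y - algebraMap R A a) := by
  simp [lineForm, symmSubst, hij.symm, hik.symm, hjk.symm]
  ring

open Classical in
/-- The substitution `X i ↦ x`, `X j ↦ -1`, all other variables `↦ 0`. -/
noncomputable def affineSubst {A : Type*} [CommRing A] (i j : σ) (x : A) : σ → A :=
  fun s => if s = i then x else if s = j then -1 else 0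

theorem aeval_affineSubst_lineForm {R A : Type*} [CommRing R] [CommRing A] [Algebra R A]
    {i j k : σ} (hij : i ≠ j) (hik : i ≠ k) (hjk : j ≠ k) (x : A) (a : R) :
    aeval (affineSubst i j x) (lineForm i j k a) = x - algebraMap R A a := by
  simp [lineForm, affineSubst, hij.symm, hik.symm, hjk.symm]
  ring

theorem map_affineSubst {A B : Type*} [CommRing A] [CommRing B] (φ : A →+* B) (i j : σ) (x : A)
    (s : σ) : φ (affineSubst i j x s) = affineSubst i j (φ x) s := by
  unfold affineSubst
  split_ifs <;> simp

theorem ringHom_aeval_eq {R S A B : Type*} [CommRing R] [CommRing S] [CommRing A] [CommRing B]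
    [Algebra R A] [Algebra S B] (φ : A →+* B) (ψ : R →+* S)
    (h : φ.comp (algebraMap R A) = (algebraMap S B).comp ψ) (u : σ → A) (p : MvPolynomial σ R) :
    φ (aeval u p) = aeval (fun s => φ (u s)) (map ψ p) := by
  induction p using MvPolynomial.induction_on with
  | C a => simpa using RingHom.congr_fun h a
  | add p q hp hq => simp [hp, hq]
  | mul_X p n hp => simp [hp]

variable {K E : Type*} [Field K] [Field E] [IsAlgClosed E] [Algebra K E] {g : Polynomial K}
  {F : MvPolynomial σ K} {i j k : σ}

theorem prod_X_sub_C_aroots (hg : g.Monic) :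
    ((g.aroots E).map fun a => Polynomial.X - Polynomial.C a).prod = g.map (algebraMap K E) :=
  ((IsAlgClosed.splits _).eq_prod_roots_of_monic (hg.map _)).symm

theorem aeval_affineSubst_eq (hg : g.Monic) (hij : i ≠ j) (hik : i ≠ k) (hjk : j ≠ k)
    (hF : map (algebraMap K E) F = ((g.aroots E).map (lineForm i j k)).prod) :
    aeval (affineSubst i j Polynomial.X) F = g := by
  refine Polynomial.map_injective _ (algebraMap K E).injective ?_
  rw [← prod_X_sub_C_aroots hg, ← Polynomial.coe_mapRingHom,
    ringHom_aeval_eq _ (algebraMap K E) (by ext; simp), hF, map_multiset_prod, Multiset.map_map]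
  simp only [map_affineSubst]
  congr 1
  refine Multiset.map_congr rfl fun a _ => ?_
  simp [aeval_affineSubst_lineForm hij hik hjk]

theorem aeval_symmSubst_eq (hg : g.Monic) (hij : i ≠ j) (hik : i ≠ k) (hjk : j ≠ k)
    (hF : map (algebraMap K E) F = ((g.aroots E).map (lineForm i j k)).prod) :
    aeval (symmSubst i j k (Polynomial.C Polynomial.X)
      (Polynomial.X : Polynomial (Polynomial K))) F = Polynomial.C g * g.map Polynomial.C := by
  have hinj : Function.Injective (Polynomial.mapRingHom (Polynomial.mapRingHom (algebraMap K E))) :=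
    Polynomial.map_injective _ (Polynomial.map_injective _ (algebraMap K E).injective)
  have h1 : Polynomial.C (g.map (algebraMap K E)) =
      ((g.aroots E).map fun a =>
        Polynomial.C (Polynomial.X - Polynomial.C a : Polynomial E)).prod := by
    rw [← prod_X_sub_C_aroots hg, map_multiset_prod, Multiset.map_map]; rfl
  have h2 : (g.map (algebraMap K E)).map (Polynomial.C : E →+* Polynomial E) =
      ((g.aroots E).map fun a =>
        (Polynomial.X - Polynomial.C (Polynomial.C a) : Polynomial (Polynomial E))).prod := by
    rw [← prod_X_sub_C_aroots hg, ← Polynomial.coe_mapRingHom, map_multiset_prod, Multiset.map_map]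
    congr 1
    refine Multiset.map_congr rfl fun a _ => ?_
    simp
  have h3 : (Polynomial.mapRingHom (algebraMap K E)).comp Polynomial.C =
      (Polynomial.C : E →+* Polynomial E).comp (algebraMap K E) := by ext; simp
  refine hinj ?_
  rw [ringHom_aeval_eq (Polynomial.mapRingHom (Polynomial.mapRingHom (algebraMap K E)))
    (algebraMap K E) (by ext; simp), hF, map_multiset_prod, Multiset.map_map, map_mul]
  simp only [Polynomial.coe_mapRingHom, Polynomial.map_C, Polynomial.map_map, h3]
  rw [← Polynomial.map_map, h1, h2, ← Multiset.prod_map_mul]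
  congr 1
  refine Multiset.map_congr rfl fun a _ => ?_
  have h4 := fun s => map_symmSubst (Polynomial.mapRingHom (Polynomial.mapRingHom
    (algebraMap K E))) i j k (Polynomial.C Polynomial.X) Polynomial.X s
  simp only [Polynomial.coe_mapRingHom] at h4
  simp [h4, aeval_symmSubst_lineForm hij hik hjk]

/-- Restriction to a line turns `F` into the irreducible `g` without loss of degree, so a factor of
`F` that restricts to a unit is constant. -/
theorem irreducible_of_map_eq_prod_lineForm (hg : g.Monic) (hirr : Irreducible g)
    (hij : i ≠ j) (hik : i ≠ k) (hjk : j ≠ k)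
    (hF : map (algebraMap K E) F = ((g.aroots E).map (lineForm i j k)).prod) :
    Irreducible F := by
  set ψ : MvPolynomial σ K →ₐ[K] Polynomial K := aeval (affineSubst i j Polynomial.X) with hψ
  have hψF : ψ F = g := aeval_affineSubst_eq hg hij hik hjk hF
  have hcard : (g.aroots E).card = g.natDegree := IsAlgClosed.card_aroots_eq_natDegree
  have hF0 : F ≠ 0 := by
    rintro rfl
    exact hirr.ne_zero (by rw [← hψF, map_zero])
  have hhom : F.IsHomogeneous g.natDegree := by
    refine isHomogeneous_of_map_injective (algebraMap K E).injective ?_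
    rw [hF, ← hcard]
    exact (isProdOfLinearForms_lineForm i j k _).isHomogeneous
  have key : ∀ a b : MvPolynomial σ K, F = a * b → IsUnit (ψ b) → IsUnit b := by
    intro a b hab hb
    have ha0 : a ≠ 0 := by rintro rfl; simp [hF0] at hab
    have hb0 : b ≠ 0 := by rintro rfl; simp [hF0] at hab
    have h1 : a.totalDegree + b.totalDegree = g.natDegree := by
      rw [← totalDegree_mul_of_isDomain ha0 hb0, ← hab, hhom.totalDegree hF0]
    have h2 : g.natDegree = (ψ a).natDegree := by
      have h3 : ψ a * ψ b = g := by rw [← map_mul, ← hab, hψF]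
      have h4 : ψ a ≠ 0 := by rintro h; rw [h, zero_mul] at h3; exact hirr.ne_zero h3.symm
      rw [← h3, Polynomial.natDegree_mul h4 hb.ne_zero, Polynomial.natDegree_eq_zero_of_isUnit hb,
        add_zero]
    have h5 : (ψ a).natDegree ≤ a.totalDegree := by
      have h6 := aeval_natDegree_le a le_rfl (affineSubst i j (Polynomial.X : Polynomial K))
        (n := 1) (fun s => by unfold affineSubst; split_ifs <;> simp)
      simpa using h6
    have h7 : b.totalDegree = 0 := by omega
    rw [totalDegree_eq_zero_iff_eq_C] at h7
    have h8 : coeff 0 b ≠ 0 := by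
      intro h
      rw [h, map_zero] at h7
      exact hb0 h7
    rw [h7]
    exact (isUnit_iff_ne_zero.2 h8).map C
  refine ⟨fun hu => hirr.not_isUnit (hψF ▸ hu.map ψ), fun a b hab => ?_⟩
  have : g = ψ a * ψ b := by rw [← map_mul, ← hab, hψF]
  rcases hirr.isUnit_or_isUnit this with h | h
  · exact Or.inl (key b a (by rw [hab, mul_comm]) h)
  · exact Or.inr (key a b hab h)

end Substitutions

/-! ### Polynomials that are linear times irreducible over an extension -/

section Univariate

open Polynomial

variable {K : Type*} [Field K] {g : K[X]} {L : Type*} [Field L]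

theorem irreducible_of_map_eq_X_sub_C_mul (σ : K →+* L) (hg : g.Monic) {a : L} {h : L[X]}
    (hgh : g.map σ = (Polynomial.X - Polynomial.C a) * h) (hh : Irreducible h) (hroot : ∀ x : K, g.eval x ≠ 0) :
    Irreducible g := by
  have h0 : (Polynomial.X - Polynomial.C a) * h ≠ 0 := mul_ne_zero (X_sub_C_ne_zero a) hh.ne_zero
  have hg0 : g ≠ 0 := hg.ne_zero
  have hdeg : g.natDegree = 1 + h.natDegree := by
    rw [← natDegree_map σ, hgh, natDegree_mul (X_sub_C_ne_zero a) hh.ne_zero, natDegree_X_sub_C]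
  have key : ∀ u v : K[X], g = u * v → h ∣ u.map σ → IsUnit v := by
    intro u v huv hd
    have hu0 : u ≠ 0 := by rintro rfl; simp [hg0] at huv
    have hv0 : v ≠ 0 := by rintro rfl; simp [hg0] at huv
    have h1 := natDegree_le_of_dvd hd (map_ne_zero hu0)
    rw [natDegree_map] at h1
    have h2 : g.natDegree = u.natDegree + v.natDegree := by rw [huv, natDegree_mul hu0 hv0]
    -- Since `h` divides `u`, the degree of `v` is at most one, and degree one would give `g` a root
    -- in `K`.
    rcases Nat.eq_zero_or_pos v.natDegree with h3 | h3
    · rw [isUnit_iff_degree_eq_zero, degree_eq_natDegree hv0, h3, Nat.cast_zero]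
    · have h4 : v.degree = 1 := by
        rw [degree_eq_natDegree hv0, show v.natDegree = 1 by omega, Nat.cast_one]
      obtain ⟨x, hx⟩ := exists_root_of_degree_eq_one h4
      refine absurd ?_ (hroot x)
      rw [huv, Polynomial.eval_mul, hx.eq_zero, mul_zero]
  refine ⟨fun hu => ?_, fun u v huv => ?_⟩
  · have h5 := natDegree_eq_zero_of_isUnit hu
    omega
  · have h6 : h ∣ u.map σ * v.map σ := by
      rw [← Polynomial.map_mul, ← huv, hgh]; exact dvd_mul_left _ _
    rcases hh.prime.dvd_or_dvd h6 with h7 | h7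
    · exact Or.inr (key u v huv h7)
    · exact Or.inl (key v u (by rw [huv, mul_comm]) h7)

/-- Here `K` plays the role of `ℚ(α)`. The cofactor of `X - x` in `g` is irreducible because its
image under `τ` is `h`; it kills `y`, so it divides every `r` that does. -/
theorem natDegree_le_of_eval₂_eq_zero {M : Type*} [Field M] {g : K[X]} (hg : g.Monic)
    (τ : K →+* L) {x : K} (hx : g.eval x = 0) {h : L[X]}
    (hgh : g.map τ = (Polynomial.X - Polynomial.C (τ x)) * h) (hh : Irreducible h) (ρ : K →+* M) {y : M}
    (hy : g.eval₂ ρ y = 0) (hxy : y ≠ ρ x) {r : K[X]} (hr : r ≠ 0) (hry : r.eval₂ ρ y = 0) :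
    g.natDegree - 1 ≤ r.natDegree := by
  set q := g /ₘ (Polynomial.X - Polynomial.C x) with hq
  have hgq : (Polynomial.X - Polynomial.C x) * q = g := mul_divByMonic_eq_iff_isRoot.2 hx
  have hqm : q.Monic := (monic_X_sub_C x).of_mul_monic_left (hgq.symm ▸ hg)
  have hqτ : q.map τ = h := by
    refine mul_left_cancel₀ (X_sub_C_ne_zero (τ x)) ?_
    rw [← hgh, ← hgq]
    simp
  have hqi : Irreducible q := hqm.irreducible_of_irreducible_map τ q (hqτ.symm ▸ hh)
  have hqy : q.eval₂ ρ y = 0 := by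
    rw [← hgq, Polynomial.eval₂_mul, mul_eq_zero] at hy
    refine hy.resolve_left ?_
    simpa [sub_eq_zero] using hxy
  have hdvd : q ∣ r := by
    by_contra hn
    obtain ⟨u, v, huv⟩ := (hqi.coprime_iff_not_dvd).2 hn
    have := congrArg (eval₂ ρ y) huv
    simp [Polynomial.eval₂_add, Polynomial.eval₂_mul, hqy, hry] at this
  have hdeg : q.natDegree = g.natDegree - 1 := by
    rw [hq, natDegree_divByMonic _ (monic_X_sub_C x), natDegree_X_sub_C]
  exact hdeg ▸ natDegree_le_of_dvd hdvd hr

end Univariate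

/-! ### Not a sum of squares over the rationals -/

section NotSumOfSquares

variable {σ : Type*}

theorem symmSubst_comm {A : Type*} [CommRing A] (i j k : σ) (x y : A) :
    symmSubst i j k x y = symmSubst i j k y x := by
  unfold symmSubst
  rw [mul_comm, add_comm]

/-- Conjugation swaps `α` and `ᾱ`, and the coordinates are symmetric in them. -/
theorem exists_real_symmSubst (i j k : σ) (α : ℂ) :
    ∃ P : σ → ℝ, ∀ s, algebraMap ℝ ℂ (P s) = symmSubst i j k α (starRingEnd ℂ α) s := by
  refine ⟨fun s => (symmSubst i j k α (starRingEnd ℂ α) s).re, fun s => ?_⟩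
  refine Complex.conj_eq_iff_re.1 ?_
  rw [map_symmSubst, Complex.conj_conj, symmSubst_comm]

theorem C_dvd_of_aeval_eq_zero {g : Polynomial ℚ} (hg : g.Monic) (hirr : Irreducible g)
    {L : Type*} [Field L] (ι : ℚ →+* L) {a : L} {h : Polynomial L}
    (hgh : g.map ι = (Polynomial.X - Polynomial.C a) * h) (hh : Irreducible h)
    {α : ℂ} (hα : Polynomial.aeval α g = 0) (hconj : starRingEnd ℂ α ≠ α)
    {i j k : σ} {P : σ → ℝ}
    (hP : ∀ s, algebraMap ℝ ℂ (P s) = symmSubst i j k α (starRingEnd ℂ α) s)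
    {p : MvPolynomial σ ℚ} (hp : aeval P p = 0)
    (hdeg : (aeval (symmSubst i j k (Polynomial.C Polynomial.X)
      (Polynomial.X : Polynomial (Polynomial ℚ))) p).natDegree < g.natDegree - 1) :
    Polynomial.C g ∣ aeval (symmSubst i j k (Polynomial.C Polynomial.X)
      (Polynomial.X : Polynomial (Polynomial ℚ))) p := by
  set q := aeval (symmSubst i j k (Polynomial.C Polynomial.X)
      (Polynomial.X : Polynomial (Polynomial ℚ))) p with hq
  have : Fact (Irreducible g) := ⟨hirr⟩
  -- Two embeddings of `ℚ[X]/(g)`: `τ` into `L` gives irreducibility of the cofactor, `ρ` into `ℂ`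
  -- gives the vanishing at `(α, ᾱ)`.
  let τ : AdjoinRoot g →+* L := AdjoinRoot.lift ι a (by
    rw [← Polynomial.eval_map, hgh]; simp)
  let ρ : AdjoinRoot g →+* ℂ := AdjoinRoot.lift (algebraMap ℚ ℂ) α hα
  have hτ : τ (AdjoinRoot.root g) = a := AdjoinRoot.lift_root _
  have hρ : ρ (AdjoinRoot.root g) = α := AdjoinRoot.lift_root _
  have hzero : (q.map (AdjoinRoot.mk g)).eval₂ ρ (starRingEnd ℂ α) = 0 := by
    have h1 := ringHom_aeval_eq
      ((Polynomial.eval₂RingHom ρ (starRingEnd ℂ α)).comp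
        (Polynomial.mapRingHom (AdjoinRoot.mk g))) (RingHom.id ℚ) (RingHom.ext_rat _ _)
      (symmSubst i j k (Polynomial.C Polynomial.X) (Polynomial.X : Polynomial (Polynomial ℚ))) p
    have h2 := ringHom_aeval_eq (algebraMap ℝ ℂ) (RingHom.id ℚ) (RingHom.ext_rat _ _) P p
    rw [hp, map_zero] at h2
    simp only [map_symmSubst, hP, map_id] at h1 h2
    have h3 : ((Polynomial.eval₂RingHom ρ (starRingEnd ℂ α)).comp
        (Polynomial.mapRingHom (AdjoinRoot.mk g))) (Polynomial.C Polynomial.X) = α := by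
      simp [hρ]
    have h4 : ((Polynomial.eval₂RingHom ρ (starRingEnd ℂ α)).comp
        (Polynomial.mapRingHom (AdjoinRoot.mk g))) Polynomial.X = starRingEnd ℂ α := by
      simp
    rw [h3, h4, ← h2] at h1
    exact h1
  have hr : q.map (AdjoinRoot.mk g) = 0 := by
    by_contra hr
    have h5 := natDegree_le_of_eval₂_eq_zero (g := g.map (AdjoinRoot.of g)) (hg.map _) τ
      (x := AdjoinRoot.root g) (by rw [Polynomial.eval_map, AdjoinRoot.eval₂_root])
      (h := h) (by rw [Polynomial.map_map, hτ, ← hgh]; congr 1; exact RingHom.ext_rat _ _) hh ρ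
      (y := starRingEnd ℂ α) ?_ (by rwa [hρ]) hr hzero
    · rw [Polynomial.natDegree_map] at h5
      have h6 : (q.map (AdjoinRoot.mk g)).natDegree ≤ q.natDegree := Polynomial.natDegree_map_le
      omega
    · rw [Polynomial.eval₂_map, RingHom.ext_rat (ρ.comp (AdjoinRoot.of g))
        ((starRingEnd ℂ).comp (algebraMap ℚ ℂ)), ← Polynomial.hom_eval₂]
      rw [Polynomial.aeval_def] at hα
      rw [hα, map_zero]
  rw [Polynomial.C_dvd_iff_dvd_coeff]
  intro m
  rw [← AdjoinRoot.mk_eq_zero, ← Polynomial.coeff_map, hr, Polynomial.coeff_zero]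

theorem not_isSumSq_of_map_eq_prod_lineForm {g : Polynomial ℚ} (hg : g.Monic)
    (hirr : Irreducible g) (hdeg : 3 ≤ g.natDegree) (hreal : ∀ x : ℝ, Polynomial.aeval x g ≠ 0)
    {L : Type*} [Field L] (ι : ℚ →+* L) {a : L} {h : Polynomial L}
    (hgh : g.map ι = (Polynomial.X - Polynomial.C a) * h) (hh : Irreducible h)
    {F : MvPolynomial σ ℚ} {i j k : σ} (hij : i ≠ j) (hik : i ≠ k) (hjk : j ≠ k)
    (hF : map (algebraMap ℚ ℂ) F = ((g.aroots ℂ).map (lineForm i j k)).prod) :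
    ¬ IsSumSq F := by
  intro hsum
  obtain ⟨α, hα⟩ := IsAlgClosed.exists_aeval_eq_zero ℂ g
    (Polynomial.degree_pos_of_irreducible hirr).ne'
  have hconj : starRingEnd ℂ α ≠ α := by
    intro h0
    obtain ⟨x, rfl⟩ := Complex.conj_eq_iff_real.1 h0
    refine hreal x ((algebraMap ℝ ℂ).injective ?_)
    rw [map_zero, ← hα, ← Polynomial.aeval_algebraMap_apply]
    rfl
  obtain ⟨P, hP⟩ := exists_real_symmSubst i j k α
  set Φ : MvPolynomial σ ℚ →ₐ[ℚ] Polynomial (Polynomial ℚ) :=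
    aeval (symmSubst i j k (Polynomial.C Polynomial.X) Polynomial.X) with hΦ
  have hΦF : Φ F = Polynomial.C g * g.map Polynomial.C := aeval_symmSubst_eq hg hij hik hjk hF
  -- Both the degree bound and the vanishing at `P` pass to each summand, by positivity, so
  -- induction applies.
  have key : ∀ s : MvPolynomial σ ℚ, IsSumSq s → (Φ s).natDegree ≤ g.natDegree → aeval P s = 0 →
      Polynomial.C g ^ 2 ∣ Φ s := by
    intro s hs
    induction hs with
    | zero => intro _ _; simp
    | @sq_add b s hs ih =>
      intro h1 h2
      have hb1 : IsSumSq (Φ (b * b)) := by rw [map_mul]; exact IsSumSq.mul_self _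
      have hs1 : IsSumSq (Φ s) := isSumSq_map Φ.toRingHom hs
      have hpos : 0 ≤ aeval P s := (isSumSq_map (aeval P : _ →ₐ[ℚ] ℝ).toRingHom hs).nonneg
      rw [map_add, map_mul] at h2
      have hb2 : aeval P b = 0 := by nlinarith [mul_self_nonneg (aeval P b)]
      have hs2 : aeval P s = 0 := by rw [hb2] at h2; simpa using h2
      rw [map_add] at h1
      have hb3 := (natDegree_le_natDegree_add_of_isSumSq
        (fun _ _ => polynomial_eq_zero_of_isSumSq_add_eq_zero) hb1 hs1).trans h1
      rw [add_comm] at h1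
      have hs3 := (natDegree_le_natDegree_add_of_isSumSq
        (fun _ _ => polynomial_eq_zero_of_isSumSq_add_eq_zero) hs1 hb1).trans h1
      rw [map_mul, ← pow_two, Polynomial.natDegree_pow] at hb3
      -- From `2 * deg (Φ b) ≤ deg g` and `3 ≤ deg g` follows `deg (Φ b) < deg g - 1`.
      have hb4 : Polynomial.C g ∣ Φ b :=
        C_dvd_of_aeval_eq_zero hg hirr ι hgh hh hα hconj hP hb2 (by rw [← hΦ]; omega)
      rw [map_add, map_mul, ← pow_two]
      exact dvd_add (pow_dvd_pow_of_dvd hb4 2) (ih hs3 hs2)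
  have hdegF : (Φ F).natDegree ≤ g.natDegree := by
    rw [hΦF]
    refine Polynomial.natDegree_C_mul_le _ _ |>.trans Polynomial.natDegree_map_le
  have hPF : aeval P F = 0 := by
    refine (algebraMap ℝ ℂ).injective ?_
    rw [ringHom_aeval_eq (algebraMap ℝ ℂ) (algebraMap ℚ ℂ) (RingHom.ext_rat _ _), hF, map_zero,
      map_multiset_prod, Multiset.map_map]
    refine Multiset.prod_eq_zero (Multiset.mem_map.2 ⟨α, ?_, ?_⟩)
    · exact Polynomial.mem_aroots.2 ⟨hg.ne_zero, hα⟩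
    · simp only [Function.comp_apply, hP]
      have := aeval_symmSubst_lineForm hij hik hjk α (starRingEnd ℂ α) α
      simpa using this
  have hdvd := key F hsum hdegF hPF
  have hCg : (Polynomial.C g : Polynomial (Polynomial ℚ)) ≠ 0 :=
    Polynomial.C_ne_zero.2 hg.ne_zero
  -- After cancelling `g(x)`, it would divide each coefficient of `g(y)`, including the leading one,
  -- which is `1`.
  rw [hΦF, pow_two, mul_dvd_mul_iff_left hCg, Polynomial.C_dvd_iff_dvd_coeff] at hdvd
  have h7 := hdvd g.natDegree
  rw [Polynomial.coeff_map, hg.coeff_natDegree, Polynomial.C_1] at h7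
  exact hirr.not_isUnit (isUnit_of_dvd_one h7)

end NotSumOfSquares

/-- A form which is the norm of a linear form `X i + a X j + a² X k` is a counterexample as soon as
the minimal polynomial of `a` has no real root and, over some field, is the product of a linear and
an irreducible factor. -/
theorem isSOSCounterexample_of_map_eq_prod_lineForm {n : ℕ} {i j k : Fin (n + 1)} (hij : i ≠ j)
    (hik : i ≠ k) (hjk : j ≠ k) {g : Polynomial ℚ} (hg : g.Monic) (hdeg : 3 ≤ g.natDegree)
    (hreal : ∀ x : ℝ, Polynomial.aeval x g ≠ 0) {L : Type*} [Field L] (ι : ℚ →+* L) {a : L}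
    {h : Polynomial L} (hgh : g.map ι = (Polynomial.X - Polynomial.C a) * h) (hh : Irreducible h)
    {F : MvPolynomial (Fin (n + 1)) ℚ}
    (hF : map (algebraMap ℚ ℂ) F = ((g.aroots ℂ).map (lineForm i j k)).prod) :
    IsSOSCounterexample n g.natDegree F := by
  have hirr : Irreducible g := by
    refine irreducible_of_map_eq_X_sub_C_mul ι hg hgh hh fun x hx => hreal (algebraMap ℚ ℝ x) ?_
    rw [Polynomial.aeval_algebraMap_apply, Polynomial.coe_aeval_eq_eval, hx, map_zero]
  have hcard : (g.aroots ℂ).card = g.natDegree := IsAlgClosed.card_aroots_eq_natDegree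
  have hprod : IsProdOfLinearForms g.natDegree (map (algebraMap ℚ ℂ) F) := by
    rw [hF, ← hcard]
    exact isProdOfLinearForms_lineForm i j k _
  refine ⟨isHomogeneous_of_map_injective (algebraMap ℚ ℂ).injective hprod.isHomogeneous,
    irreducible_of_map_eq_prod_lineForm hg hirr hij hik hjk hF, hprod, ?_,
    not_isSumSq_of_map_eq_prod_lineForm hg hirr hdeg hreal ι hgh hh hij hik hjk hF⟩
  refine isSumTwoSq_of_conj_roots (s := g.aroots ℂ) (i := i) (j := j) (k := k) ?_ ?_ ?_ ?_
  · exact (Polynomial.nodup_aroots_iff_of_splits hg.ne_zero (IsAlgClosed.splits _)).2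
      hirr.separable
  · intro α hα
    rw [Polynomial.mem_aroots] at hα ⊢
    refine ⟨hα.1, ?_⟩
    rw [Polynomial.aeval_def, RingHom.ext_rat (algebraMap ℚ ℂ)
      ((starRingEnd ℂ).comp (algebraMap ℚ ℂ)), ← Polynomial.hom_eval₂, ← Polynomial.aeval_def,
      hα.2, map_zero]
  · intro α hα him
    obtain ⟨x, rfl⟩ := Complex.conj_eq_iff_real.1 (Complex.conj_eq_iff_im.2 him)
    refine hreal x ((algebraMap ℝ ℂ).injective ?_)
    rw [map_zero, ← (Polynomial.mem_aroots.1 hα).2, ← Polynomial.aeval_algebraMap_apply]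
    rfl
  · rw [map_map, ← hF]
    congr 1

/-! ### Splitting off a `p`-adic root -/

section Hensel

variable {p : ℕ} [Fact p.Prime]

theorem PadicInt.toZMod_eq_zero_iff_norm_lt_one (x : ℤ_[p]) : PadicInt.toZMod x = 0 ↔ ‖x‖ < 1 := by
  rw [← RingHom.mem_ker, PadicInt.ker_toZMod, IsLocalRing.mem_maximalIdeal, mem_nonunits_iff,
    PadicInt.isUnit_iff, lt_iff_le_and_ne]
  exact ⟨fun h => ⟨PadicInt.norm_le_one x, h⟩, fun h => h.2⟩

theorem PadicInt.exists_eq_X_sub_C_mul {G : Polynomial ℤ_[p]} (hG : G.Monic) (b : ℤ_[p])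
    (h0 : PadicInt.toZMod (G.eval b) = 0) (h1 : PadicInt.toZMod (G.derivative.eval b) ≠ 0) :
    ∃ (a : ℤ_[p]) (h : Polynomial ℤ_[p]), h.Monic ∧ G = (Polynomial.X - Polynomial.C a) * h ∧
      PadicInt.toZMod a = PadicInt.toZMod b := by
  have hd : ‖G.derivative.eval b‖ = 1 :=
    le_antisymm (PadicInt.norm_le_one _)
      (not_lt.1 fun h => h1 ((PadicInt.toZMod_eq_zero_iff_norm_lt_one _).2 h))
  have hn : ‖G.eval b‖ < 1 := (PadicInt.toZMod_eq_zero_iff_norm_lt_one _).1 h0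
  obtain ⟨a, ha, hab, -⟩ := hensels_lemma (F := G) (a := b)
    (by simpa [Polynomial.coe_aeval_eq_eval, hd] using hn)
  rw [Polynomial.coe_aeval_eq_eval] at ha hab
  have hmul : (Polynomial.X - Polynomial.C a) * (G /ₘ (Polynomial.X - Polynomial.C a)) = G :=
    Polynomial.mul_divByMonic_eq_iff_isRoot.2 ha
  refine ⟨a, _, (Polynomial.monic_X_sub_C a).of_mul_monic_left (hmul.symm ▸ hG), hmul.symm, ?_⟩
  rw [hd, ← PadicInt.toZMod_eq_zero_iff_norm_lt_one, map_sub, sub_eq_zero] at hab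
  exact hab

/-- Gauss's lemma moves irreducibility from `ℤ_[p]` to `ℚ_[p]`. -/
theorem PadicInt.map_eq_X_sub_C_mul {G : Polynomial ℤ} {a : ℤ_[p]} {h : Polynomial ℤ_[p]}
    (hm : h.Monic) (hirr : Irreducible h)
    (hGh : G.map (Int.castRingHom ℤ_[p]) = (Polynomial.X - Polynomial.C a) * h) :
    (G.map (Int.castRingHom ℚ)).map (algebraMap ℚ ℚ_[p]) =
      (Polynomial.X - Polynomial.C (a : ℚ_[p])) * h.map (algebraMap ℤ_[p] ℚ_[p]) ∧
      Irreducible (h.map (algebraMap ℤ_[p] ℚ_[p])) := by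
  refine ⟨?_, hm.irreducible_iff_irreducible_map_fraction_map.1 hirr⟩
  have := congrArg (Polynomial.map (algebraMap ℤ_[p] ℚ_[p])) hGh
  rw [Polynomial.map_map, Polynomial.map_mul] at this
  rw [Polynomial.map_map, RingHom.ext_int ((algebraMap ℚ ℚ_[p]).comp (Int.castRingHom ℚ))
    ((algebraMap ℤ_[p] ℚ_[p]).comp (Int.castRingHom ℤ_[p])), this]
  simp

end Hensel

/-! ### A suitable polynomial in every even degree -/

section Family

/-- The polynomial `x ^ (m + 1) - x ^ m + 2`. -/
noncomputable def familyPoly (m : ℕ) : Polynomial ℤ :=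
  Polynomial.X ^ (m + 1) - Polynomial.X ^ m + 2

theorem natDegree_familyPoly (m : ℕ) : (familyPoly m).natDegree = m + 1 := by
  unfold familyPoly
  compute_degree!

theorem monic_familyPoly (m : ℕ) : (familyPoly m).Monic := by
  unfold familyPoly
  monicity!

theorem familyPoly_no_real_root {m : ℕ} (hm : Odd m) (x : ℝ) :
    Polynomial.aeval x ((familyPoly m).map (Int.castRingHom ℚ)) ≠ 0 := by
  have h1 : Polynomial.aeval x ((familyPoly m).map (Int.castRingHom ℚ)) =
      x ^ m * (x - 1) + 2 := by
    simp [familyPoly, map_ofNat]; ring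
  rw [h1]
  refine ne_of_gt ?_
  -- `x ^ m * (x - 1)` is nonnegative for `x ≤ 0` (as `m` is odd) and for `1 ≤ x`, and at least `-1`
  -- in between.
  rcases le_total x 0 with hx | hx
  · have := mul_nonneg_of_nonpos_of_nonpos (hm.pow_nonpos hx) (show x - 1 ≤ 0 by linarith)
    linarith
  · rcases le_total x 1 with hx1 | hx1
    · have h2 := pow_le_one₀ (n := m) hx hx1
      have h3 := pow_nonneg hx m
      nlinarith
    · have := mul_nonneg (pow_nonneg hx m) (sub_nonneg.2 hx1)
      linarith

/-- Modulo 2 the polynomial is `x ^ m * (x - 1)`. The simple root `1` lifts, and the cofactor,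
congruent to `x ^ m`, is Eisenstein. -/
theorem familyPoly_padic_factor {m : ℕ} (hm : 1 ≤ m) :
    ∃ (a : ℤ_[2]) (h : Polynomial ℤ_[2]), h.Monic ∧ Irreducible h ∧
      (familyPoly m).map (Int.castRingHom ℤ_[2]) = (Polynomial.X - Polynomial.C a) * h := by
  have h2 : (2 : ZMod 2) = 0 := by decide
  obtain ⟨a, h, hmon, hGh, ha⟩ := PadicInt.exists_eq_X_sub_C_mul
    (G := (familyPoly m).map (Int.castRingHom ℤ_[2])) ((monic_familyPoly m).map _) 1
    (by simp [familyPoly, map_ofNat, h2])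
    (by simp [familyPoly, Polynomial.derivative_X_pow])
  rw [map_one] at ha
  refine ⟨a, h, hmon, ?_, hGh⟩
  have hbar : h.map PadicInt.toZMod = Polynomial.X ^ m := by
    refine mul_left_cancel₀ (Polynomial.X_sub_C_ne_zero (1 : ZMod 2)) ?_
    have h3 := congrArg (Polynomial.map (PadicInt.toZMod (p := 2))) hGh
    rw [Polynomial.map_mul] at h3
    simp only [familyPoly, Polynomial.map_sub, Polynomial.map_add, Polynomial.map_pow,
      Polynomial.map_X, Polynomial.map_ofNat, Polynomial.map_C, ha] at h3
    have h4 : (2 : Polynomial (ZMod 2)) = 0 := by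
      rw [← Polynomial.C_ofNat, h2, Polynomial.C_0]
    rw [← h3, h4, Polynomial.C_1]
    ring
  have hdeg : h.natDegree = m := by
    rw [← hmon.natDegree_map PadicInt.toZMod, hbar, Polynomial.natDegree_X_pow]
  have hcoeff : a * h.coeff 0 = -2 := by
    have h5 := congrArg (Polynomial.eval 0) hGh
    rw [Polynomial.coeff_zero_eq_eval_zero]
    simp [familyPoly, zero_pow (by omega : m ≠ 0)] at h5
    linear_combination h5
  refine (hmon.isEisensteinAt_of_mem_of_notMem (𝓟 := IsLocalRing.maximalIdeal ℤ_[2])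
    (IsLocalRing.maximalIdeal.isMaximal _).ne_top ?_ ?_).irreducible
    (IsLocalRing.maximalIdeal.isMaximal _).isPrime hmon.isPrimitive (by omega)
  · intro n hn
    rw [← PadicInt.ker_toZMod, RingHom.mem_ker, ← Polynomial.coeff_map, hbar,
      Polynomial.coeff_X_pow, if_neg (by omega)]
  -- If `4` divided `h.coeff 0`, it would divide `a * h.coeff 0 = -2`.
  · intro h6
    have h7 : (-2 : ℤ_[2]) ∈ IsLocalRing.maximalIdeal ℤ_[2] ^ 2 := by
      rw [← hcoeff]; exact Ideal.mul_mem_left _ a h6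
    rw [PadicInt.maximalIdeal_eq_span_p, Ideal.span_singleton_pow, Ideal.mem_span_singleton] at h7
    obtain ⟨c, hc⟩ := h7
    have h8 : (2 : ℤ_[2]) * (2 * c + 1) = 0 := by
      push_cast at hc
      linear_combination -hc
    have h9 : (2 * c + 1 : ℤ_[2]) = 0 := (mul_eq_zero.1 h8).resolve_left two_ne_zero
    have h10 := congrArg (PadicInt.toZMod (p := 2)) h9
    simp [map_ofNat, h2] at h10

theorem exists_isSOSCounterexample {n d : ℕ} (hn : 2 ≤ n) (hd : 4 ≤ d) (hev : Even d) :
    ∃ f : MvPolynomial (Fin (n + 1)) ℚ, IsSOSCounterexample n d f := by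
  obtain ⟨m, rfl⟩ : ∃ m, d = m + 1 := ⟨d - 1, by omega⟩
  have hodd : Odd m := by
    rw [Nat.even_add_one, Nat.not_even_iff_odd] at hev
    exact hev
  have hmon : ((familyPoly m).map (Int.castRingHom ℚ)).Monic :=
    (monic_familyPoly m).map _
  have hdeg : ((familyPoly m).map (Int.castRingHom ℚ)).natDegree = m + 1 := by
    rw [(monic_familyPoly m).natDegree_map, natDegree_familyPoly m]
  obtain ⟨a, h, hm, hirr, hGh⟩ := familyPoly_padic_factor (m := m) (by omega)
  obtain ⟨h1, h2⟩ := PadicInt.map_eq_X_sub_C_mul hm hirr hGh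
  obtain ⟨F, hF⟩ := exists_map_eq_prod_lineForm (E := ℂ) _ hmon (⟨0, by omega⟩ : Fin (n + 1))
    ⟨1, by omega⟩ ⟨2, by omega⟩
  refine ⟨F, ?_⟩
  rw [← hdeg]
  exact isSOSCounterexample_of_map_eq_prod_lineForm (by simp) (by simp) (by simp) hmon
    (by omega) (familyPoly_no_real_root hodd) _ h1 h2 hF

end Family

/-! ### The explicit ternary quartic -/

section Example

/-- The polynomial `x ^ 4 - x + 1`. -/
noncomputable def examplePoly : Polynomial ℤ :=
  Polynomial.X ^ 4 - Polynomial.X + 1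

theorem natDegree_examplePoly : examplePoly.natDegree = 4 := by
  unfold examplePoly
  compute_degree!

theorem monic_examplePoly : examplePoly.Monic := by
  unfold examplePoly
  monicity!

theorem examplePoly_no_real_root (x : ℝ) :
    Polynomial.aeval x (examplePoly.map (Int.castRingHom ℚ)) ≠ 0 := by
  have h1 : Polynomial.aeval x (examplePoly.map (Int.castRingHom ℚ)) = x ^ 4 - x + 1 := by
    simp [examplePoly]
  rw [h1]
  -- `x ^ 4 - x + 1 = (x ^ 2 - 1/2) ^ 2 + (x - 1/2) ^ 2 + 1/2`.
  nlinarith [sq_nonneg (x ^ 2 - 1 / 2), sq_nonneg (x - 1 / 2)]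

/-- Modulo 3, `-1` is a simple root, and the cubic cofactor is irreducible because it has no root
there. -/
theorem examplePoly_padic_factor :
    ∃ (a : ℤ_[3]) (h : Polynomial ℤ_[3]), h.Monic ∧ Irreducible h ∧
      examplePoly.map (Int.castRingHom ℤ_[3]) = (Polynomial.X - Polynomial.C a) * h := by
  have h3 : (3 : ZMod 3) = 0 := by decide
  obtain ⟨a, h, hmon, hGh, ha⟩ := PadicInt.exists_eq_X_sub_C_mul
    (G := examplePoly.map (Int.castRingHom ℤ_[3])) (monic_examplePoly.map _) (-1)
    (by simp [examplePoly]; decide) (by simp [examplePoly, map_ofNat]; decide)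
  rw [map_neg, map_one] at ha
  refine ⟨a, h, hmon, ?_, hGh⟩
  have hbar : h.map PadicInt.toZMod =
      Polynomial.X ^ 3 - Polynomial.X ^ 2 + Polynomial.X + 1 := by
    refine mul_left_cancel₀ (Polynomial.X_sub_C_ne_zero (-1 : ZMod 3)) ?_
    have h5 := congrArg (Polynomial.map (PadicInt.toZMod (p := 3))) hGh
    rw [Polynomial.map_mul] at h5
    simp only [examplePoly, Polynomial.map_sub, Polynomial.map_add, Polynomial.map_pow,
      Polynomial.map_X, Polynomial.map_one, Polynomial.map_C, ha] at h5
    have h4 : (3 : Polynomial (ZMod 3)) = 0 := by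
      rw [← Polynomial.C_ofNat, h3, Polynomial.C_0]
    rw [← h5, Polynomial.C_neg, Polynomial.C_1]
    linear_combination (-Polynomial.X) * h4
  refine hmon.irreducible_of_irreducible_map PadicInt.toZMod h ?_
  rw [hbar]
  refine Polynomial.irreducible_of_degree_le_three_of_not_isRoot ?_ ?_
  · have : (Polynomial.X ^ 3 - Polynomial.X ^ 2 + Polynomial.X + 1 :
        Polynomial (ZMod 3)).natDegree = 3 := by compute_degree!
    rw [this]
    decide
  · intro x
    simp only [Polynomial.IsRoot.def, Polynomial.eval_add, Polynomial.eval_sub,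
      Polynomial.eval_pow, Polynomial.eval_X, Polynomial.eval_one]
    revert x
    decide

theorem prod_lineForm_four {σ R : Type*} [CommRing R] (i j k : σ) {a b c e : R}
    (h1 : a + b + c + e = 0) (h2 : a * b + a * c + a * e + b * c + b * e + c * e = 0)
    (h3 : a * b * c + a * b * e + a * c * e + b * c * e = 1) (h4 : a * b * c * e = 1) :
    lineForm i j k a * lineForm i j k b * lineForm i j k c * lineForm i j k e =
      X i ^ 4 + X i * X j ^ 3 + X j ^ 4 - 3 * X i ^ 2 * X j * X k - 4 * X i * X j ^ 2 * X k
        + 2 * X i ^ 2 * X k ^ 2 + X i * X k ^ 3 + X j * X k ^ 3 + X k ^ 4 := by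
  -- The product of four lines written in the elementary symmetric functions of the parameters; for
  -- `x ^ 4 - x + 1` these are `0, 0, 1, 1`.
  have general : ∀ (A : Type _) [CommRing A] (x y z a b c e s1 s2 s3 s4 : A),
      a + b + c + e = s1 → a * b + a * c + a * e + b * c + b * e + c * e = s2 →
      a * b * c + a * b * e + a * c * e + b * c * e = s3 → a * b * c * e = s4 →
      (x + a * y + a ^ 2 * z) * (x + b * y + b ^ 2 * z) * (x + c * y + c ^ 2 * z) *
        (x + e * y + e ^ 2 * z) =
      x ^ 4 + s1 * x ^ 3 * y + (s1 ^ 2 - 2 * s2) * x ^ 3 * z + s2 * x ^ 2 * y ^ 2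
        + (s1 * s2 - 3 * s3) * x ^ 2 * y * z + (s2 ^ 2 - 2 * s1 * s3 + 2 * s4) * x ^ 2 * z ^ 2
        + s3 * x * y ^ 3 + (s1 * s3 - 4 * s4) * x * y ^ 2 * z
        + (s2 * s3 - 3 * s1 * s4) * x * y * z ^ 2 + (s3 ^ 2 - 2 * s2 * s4) * x * z ^ 3
        + s4 * y ^ 4 + s4 * s1 * y ^ 3 * z + s4 * s2 * y ^ 2 * z ^ 2 + s4 * s3 * y * z ^ 3
        + s4 ^ 2 * z ^ 4 := by
    intro A _ x y z a b c e s1 s2 s3 s4 h1 h2 h3 h4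
    subst h1 h2 h3 h4
    ring
  have := general (MvPolynomial σ R) (X i) (X j) (X k) (C a) (C b) (C c) (C e) 0 0 1 1
    (by simp only [← C_add, h1, C_0]) (by simp only [← C_mul, ← C_add, h2, C_0])
    (by simp only [← C_mul, ← C_add, h3, C_1]) (by simp only [← C_mul, h4, C_1])
  simp only [lineForm, C_pow]
  rw [this]
  ring

theorem map_exampleQuartic :
    map (algebraMap ℚ ℂ) exampleQuartic =
      (((examplePoly.map (Int.castRingHom ℚ)).aroots ℂ).map (lineForm 0 1 2)).prod := by
  have hmon : (examplePoly.map (Int.castRingHom ℚ)).Monic := monic_examplePoly.map _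
  have hcard : ((examplePoly.map (Int.castRingHom ℚ)).aroots ℂ).card = 4 := by
    rw [IsAlgClosed.card_aroots_eq_natDegree, monic_examplePoly.natDegree_map,
      natDegree_examplePoly]
  have hprod := prod_X_sub_C_aroots (E := ℂ) hmon
  obtain ⟨a, b, c, e, hs⟩ := Multiset.card_eq_four.1 hcard
  have hs' : (examplePoly.map (Int.castRingHom ℚ)).aroots ℂ = a ::ₘ b ::ₘ c ::ₘ {e} := hs
  rw [hs'] at hprod ⊢
  simp only [Multiset.map_cons, Multiset.map_singleton, Multiset.prod_cons,
    Multiset.prod_singleton] at hprod ⊢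
  have hG : (examplePoly.map (Int.castRingHom ℚ)).map (algebraMap ℚ ℂ) =
      Polynomial.X ^ 4 - Polynomial.X + 1 := by simp [examplePoly]
  rw [hG] at hprod
  have hq : (Polynomial.X ^ 4 - Polynomial.X + 1 : Polynomial ℂ) =
      Polynomial.X ^ 4 - Polynomial.C (a + b + c + e) * Polynomial.X ^ 3
        + Polynomial.C (a * b + a * c + a * e + b * c + b * e + c * e) * Polynomial.X ^ 2
        - Polynomial.C (a * b * c + a * b * e + a * c * e + b * c * e) * Polynomial.X
        + Polynomial.C (a * b * c * e) := by
    rw [← hprod]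
    simp only [Polynomial.C_add, Polynomial.C_mul]
    ring
  have hc (m : ℕ) := congrArg (fun q => Polynomial.coeff q m) hq
  have c0 := hc 0
  have c1 := hc 1
  have c2 := hc 2
  have c3 := hc 3
  simp [Polynomial.coeff_X, Polynomial.coeff_one, -map_add, -map_mul] at c0 c1 c2 c3
  rw [← mul_assoc, ← mul_assoc, prod_lineForm_four]
  · simp [exampleQuartic]
  · linear_combination c3
  · linear_combination -c2
  · linear_combination c1
  · linear_combination -c0

theorem isSOSCounterexample_exampleQuartic : IsSOSCounterexample 2 4 exampleQuartic := by
  obtain ⟨a, h, hm, hirr, hGh⟩ := examplePoly_padic_factor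
  obtain ⟨h1, h2⟩ := PadicInt.map_eq_X_sub_C_mul hm hirr hGh
  have hdeg : (examplePoly.map (Int.castRingHom ℚ)).natDegree = 4 := by
    rw [monic_examplePoly.natDegree_map, natDegree_examplePoly]
  have := isSOSCounterexample_of_map_eq_prod_lineForm (i := (0 : Fin (2 + 1))) (j := 1) (k := 2)
    (by decide) (by decide) (by decide) (monic_examplePoly.map (Int.castRingHom ℚ)) (by omega)
    examplePoly_no_real_root _ h1 h2 map_exampleQuartic
  rwa [hdeg] at this

end Example

theorem theorem2p1 :
    (∀ n d : ℕ, 2 ≤ n → 4 ≤ d → Even d →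
      ∃ f : MvPolynomial (Fin (n + 1)) ℚ, IsSOSCounterexample n d f) ∧
    IsSOSCounterexample 2 4 exampleQuartic :=
  ⟨fun _ _ hn hd hev => exists_isSOSCounterexample hn hd hev, isSOSCounterexample_exampleQuartic⟩
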